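/- For a Lebesgue measurable set $F\subset\mathbb R^n$ let $\operatorname{Per}(F)=\sup\{\int_F\operatorname{div}\varphi\,dx:\varphi\in C^1_c(\mathbb R^n;\mathbb R^n),\ |\varphi|\le 1\}\in[0,\infty]$ be its perimeter, and for $E\subset\mathbb R^n$ let $d_E$ be the signed distance function to $E$ ($d_E=\operatorname{dist}(\cdot,E)$ outside $E$, $d_E=-\operatorname{dist}(\cdot,\mathbb R^n\setminus E)$ inside $E$, with $\operatorname{dist}(\cdot,\emptyset)=+\infty$). A set $E\subset\mathbb R^n$ is called a minimizing hull if $|\partial E|=0$ and $\operatorname{Per}(E)\le\operatorname{Per}(F)$ for every $F\supset E$ with $F\setminus E$ compact. For $h>0$, a set $E$ and an obstacle $\Omega\subset E$, consider the problem of minimizing $$\operatorname{Per}(F)+\frac1h\int_{F\Delta E}|d_E|\,dx$$ among all Lebesgue measurable sets $F\supset\Omega$; a minimizer is a set $F$ at which the minimum is attained and finite, and the maximal minimizer, denoted $E_h$, is the minimizer that contains every other minimizer up to Lebesgue null sets (it is unique up to null sets). Let $h>0$, let $\Omega^1\subset\Omega^2\subset\mathbb R^n$ be two obstacles, and let $E^1\subset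 E^2$ be two minimizing hulls with $\Omega^1\subset E^1$ and $\Omega^2\subset E^2$. Let $E^1_h$ and $E^2_h$ be the maximal minimizers of the above problem for $(\Omega,E)=(\Omega^1,E^1)$ and $(\Omega,E)=(\Omega^2,E^2)$ respectively. Then $E^1_h\subset E^2_h$ up to a Lebesgue null set. -/

import Mathlib

open MeasureTheory
open scoped ENNReal symmDiff

noncomputable section

/-- The divergence `∑ᵢ ∂ᵢ φᵢ` of a vector field on `ℝⁿ`. -/
def divergence {n : ℕ} (φ : EuclideanSpace ℝ (Fin n) → EuclideanSpace ℝ (Fin n))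
    (x : EuclideanSpace ℝ (Fin n)) : ℝ :=
  ∑ i : Fin n, (fderiv ℝ φ x (EuclideanSpace.single i 1)) i

/-- The (De Giorgi) perimeter of a Lebesgue measurable set `F ⊆ ℝⁿ`: the supremum of `∫_F div φ`
over compactly supported `C¹` vector fields `φ` with `|φ| ≤ 1`; it may be `∞`. -/
def perimeter {n : ℕ} (F : Set (EuclideanSpace ℝ (Fin n))) : ℝ≥0∞ :=
  ⨆ (φ : EuclideanSpace ℝ (Fin n) → EuclideanSpace ℝ (Fin n))
    (_ : ContDiff ℝ 1 φ ∧ HasCompactSupport φ ∧ ∀ x, ‖φ x‖ ≤ 1),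
    ENNReal.ofReal (∫ x in F, divergence φ x)

/-- The signed distance function `d_E`: `dist(x, E)` outside `E` and `-dist(x, Eᶜ)` inside `E`.
At every point at least one of the two terms vanishes. The distance to the empty set is `∞`, so that
`d_∅ = ∞` and `d_{ℝⁿ} = -∞`. -/
def setSignedDist {n : ℕ} (E : Set (EuclideanSpace ℝ (Fin n))) (x : EuclideanSpace ℝ (Fin n)) :
    EReal :=
  (Metric.infEDist x E : EReal) - (Metric.infEDist x Eᶜ : EReal)

/-- `E` is a minimizing hull: `|∂E| = 0` and `Per(E) ≤ Per(F)` for all `F ⊇ E` with `F \ E` compact.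
The first condition makes `E`, and hence every such `F`, Lebesgue measurable. -/
def IsMinimizingHull {n : ℕ} (E : Set (EuclideanSpace ℝ (Fin n))) : Prop :=
  volume (frontier E) = 0 ∧
    ∀ F : Set (EuclideanSpace ℝ (Fin n)), E ⊆ F → IsCompact (F \ E) → perimeter E ≤ perimeter F

/-- The functional `F ↦ Per(F) + (1/h) ∫_{F Δ E} |d_E|` of the minimizing scheme with step `h`. -/
def schemeEnergy {n : ℕ} (h : ℝ) (E F : Set (EuclideanSpace ℝ (Fin n))) : ℝ≥0∞ :=
  perimeter F + ENNReal.ofReal (1 / h) * ∫⁻ x in F ∆ E, (setSignedDist E x).abs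

/-- `F` solves one step of the scheme from `E` with obstacle `Ω`: among the Lebesgue measurable sets
that contain `Ω`, it minimizes the functional, with a finite minimum. (If `Ω ⊆ E` and `E` has finite
perimeter, the minimum is at most `Per(E)`, hence finite.) -/
def IsSchemeMinimizer {n : ℕ} (h : ℝ) (Ω E F : Set (EuclideanSpace ℝ (Fin n))) : Prop :=
  NullMeasurableSet F ∧ Ω ⊆ F ∧ schemeEnergy h E F ≠ ∞ ∧
    ∀ G : Set (EuclideanSpace ℝ (Fin n)), NullMeasurableSet G → Ω ⊆ G →
      schemeEnergy h E F ≤ schemeEnergy h E G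

/-- `F` is the maximal minimizer: a minimizer that contains every other one. As usual for sets of
finite perimeter, this is meant up to Lebesgue null sets (which do not change the functional). -/
def IsMaximalSchemeMinimizer {n : ℕ} (h : ℝ) (Ω E F : Set (EuclideanSpace ℝ (Fin n))) : Prop :=
  IsSchemeMinimizer h Ω E F ∧
    ∀ G : Set (EuclideanSpace ℝ (Fin n)), IsSchemeMinimizer h Ω E G → G ≤ᵐ[volume] F

end

open Filter Topology

/-! The functional is submodular across the two problems: replacing `F₁, F₂` by `F₁ ∩ F₂, F₁ ∪ F₂`
does not increase the sum of the two energies (`schemeEnergy_inter_add_schemeEnergy_union_le`). The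
intersection competes with `F₁` and the union with `F₂`, so minimality of `F₁` forces the union to
minimize the second problem, and maximality of `F₂` absorbs it.

For the distance term this is a pointwise inequality, from monotonicity of distances under `E₁ ⊆
E₂`. For the perimeter (`perimeter_union_add_perimeter_inter_le`), the variation of max and min is
first bounded for smooth functions. If `χ` is a smooth cutoff for `{f > g}`, then testing max with
`φ` and min with `ψ` amounts to testing `f` with `χφ + (1-χ)ψ` and `g` with `(1-χ)φ + χψ`, which are
again admissible. Mollification carries this over to indicator functions. -/

/-- The vector fields admissible in the definition of the perimeter. -/
def IsTestField {n : ℕ} (φ : EuclideanSpace ℝ (Fin n) → EuclideanSpace ℝ (Fin n)) : Prop :=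
  ContDiff ℝ 1 φ ∧ HasCompactSupport φ ∧ ∀ x, ‖φ x‖ ≤ 1

/-! ### Divergence calculus and the divergence theorem -/

section Divergence

variable {n : ℕ} {φ ψ : EuclideanSpace ℝ (Fin n) → EuclideanSpace ℝ (Fin n)}

lemma continuous_divergence (hφ : ContDiff ℝ 1 φ) : Continuous (divergence φ) := by
  have h := hφ.continuous_fderiv one_ne_zero
  unfold divergence
  fun_prop

lemma hasCompactSupport_divergence (hφ : HasCompactSupport φ) :
    HasCompactSupport (divergence φ) := by
  refine (hφ.fderiv (𝕜 := ℝ)).mono' fun x hx => subset_tsupport _ ?_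
  intro h0
  apply hx
  simp [divergence, h0]

lemma integrable_divergence (hφ : ContDiff ℝ 1 φ) (hc : HasCompactSupport φ) :
    Integrable (divergence φ) :=
  (continuous_divergence hφ).integrable_of_hasCompactSupport (hasCompactSupport_divergence hc)

lemma HasCompactSupport.smul_field (hφ : HasCompactSupport φ)
    (f : EuclideanSpace ℝ (Fin n) → ℝ) : HasCompactSupport fun x => f x • φ x :=
  hφ.mono fun x hx h0 => hx (by simp [h0])

lemma HasCompactSupport.sub_field (hφ : HasCompactSupport φ) (hψ : HasCompactSupport ψ) :
    HasCompactSupport fun x => φ x - ψ x :=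
  hφ.sub hψ

lemma integrable_mul_divergence {f : EuclideanSpace ℝ (Fin n) → ℝ} (hf : Continuous f)
    (hφ : ContDiff ℝ 1 φ) (hc : HasCompactSupport φ) :
    Integrable fun x => f x * divergence φ x :=
  (hf.mul (continuous_divergence hφ)).integrable_of_hasCompactSupport
    ((hasCompactSupport_divergence hc).mono fun x hx h0 => hx (by simp [h0]))

lemma divergence_add (hφ : ContDiff ℝ 1 φ) (hψ : ContDiff ℝ 1 ψ)
    (x : EuclideanSpace ℝ (Fin n)) :
    divergence (fun y => φ y + ψ y) x = divergence φ x + divergence ψ x := by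
  have h1 := (hφ.differentiable one_ne_zero) x
  have h2 := (hψ.differentiable one_ne_zero) x
  simp [divergence, fderiv_fun_add h1 h2, Finset.sum_add_distrib]

lemma divergence_sub (hφ : ContDiff ℝ 1 φ) (hψ : ContDiff ℝ 1 ψ)
    (x : EuclideanSpace ℝ (Fin n)) :
    divergence (fun y => φ y - ψ y) x = divergence φ x - divergence ψ x := by
  have h1 := (hφ.differentiable one_ne_zero) x
  have h2 := (hψ.differentiable one_ne_zero) x
  simp [divergence, fderiv_fun_sub h1 h2, Finset.sum_sub_distrib]

lemma divergence_smul {f : EuclideanSpace ℝ (Fin n) → ℝ} (hf : ContDiff ℝ 1 f)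
    (hφ : ContDiff ℝ 1 φ) (x : EuclideanSpace ℝ (Fin n)) :
    divergence (fun y => f y • φ y) x = f x * divergence φ x + fderiv ℝ f x (φ x) := by
  have h1 := (hf.differentiable one_ne_zero) x
  have h2 := (hφ.differentiable one_ne_zero) x
  have h3 : φ x = ∑ i, φ x i • EuclideanSpace.single i (1 : ℝ) := by
    ext j
    simp [Finset.sum_apply, Pi.single_apply]
  simp only [divergence, fderiv_fun_smul h1 h2]
  conv_rhs => rw [h3]
  simp [Finset.sum_add_distrib, Finset.mul_sum, mul_comm]

lemma divergence_comp_add_right (t x : EuclideanSpace ℝ (Fin n)) :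
    divergence (fun y => φ (y + t)) x = divergence φ (x + t) := by
  simp [divergence, fderiv_comp_add_right]

/-- Integration by parts of each directional derivative against the constant function 1. -/
lemma integral_divergence_eq_zero (hφ : ContDiff ℝ 1 φ) (hc : HasCompactSupport φ) :
    ∫ x, divergence φ x = 0 := by
  have hd := hφ.continuous_fderiv one_ne_zero
  have key (v : EuclideanSpace ℝ (Fin n)) : ∫ x, fderiv ℝ φ x v = 0 := by
    have hi : Integrable (fun x => fderiv ℝ φ x v) :=
      (by fun_prop : Continuous fun x => fderiv ℝ φ x v).integrable_of_hasCompactSupport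
        (hc.fderiv_apply (𝕜 := ℝ) v)
    have := integral_smul_fderiv_eq_neg_fderiv_smul_of_integrable (μ := volume)
      (f := fun _ : EuclideanSpace ℝ (Fin n) => (1 : ℝ)) (g := φ) (v := v)
      (by simp) (by simpa using hi)
      (by simpa using hφ.continuous.integrable_of_hasCompactSupport hc)
      (fun x _ => by fun_prop) (fun x _ => (hφ.differentiable one_ne_zero) x)
    simpa using this
  have hint (v : EuclideanSpace ℝ (Fin n)) : Integrable (fun x => fderiv ℝ φ x v) :=
    (by fun_prop : Continuous fun x => fderiv ℝ φ x v).integrable_of_hasCompactSupport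
      (hc.fderiv_apply (𝕜 := ℝ) v)
  unfold divergence
  rw [integral_finsetSum]
  · refine Finset.sum_eq_zero fun i _ => ?_
    have := (EuclideanSpace.proj (𝕜 := ℝ) i).integral_comp_comm
      (hint (EuclideanSpace.single i 1))
    simpa [key] using this
  · intro i _
    exact (EuclideanSpace.proj (𝕜 := ℝ) i).integrable_comp (hint (EuclideanSpace.single i 1))

end Divergence

/-! ### Smooth positive part -/

section SmoothMax

/-- A smooth approximation of the positive part. -/
noncomputable def smoothPos (δ t : ℝ) : ℝ := (t + √(t ^ 2 + δ ^ 2)) / 2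

/-- The derivative in `t` of `smoothPos δ t`. -/
noncomputable def smoothStep (δ t : ℝ) : ℝ := (1 + t / √(t ^ 2 + δ ^ 2)) / 2

lemma sq_add_sq_pos {δ : ℝ} (hδ : 0 < δ) (t : ℝ) : 0 < t ^ 2 + δ ^ 2 := by positivity

lemma contDiff_smoothPos {δ : ℝ} (hδ : 0 < δ) : ContDiff ℝ 1 (smoothPos δ) := by
  have h := fun t => (sq_add_sq_pos hδ t).ne'
  unfold smoothPos
  fun_prop (disch := assumption)

lemma contDiff_smoothStep {δ : ℝ} (hδ : 0 < δ) : ContDiff ℝ 1 (smoothStep δ) := by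
  have h := fun t => (sq_add_sq_pos hδ t).ne'
  have h' := fun t => (Real.sqrt_pos.2 (sq_add_sq_pos hδ t)).ne'
  unfold smoothStep
  fun_prop (disch := assumption)

lemma continuous_smoothPos_uncurry : Continuous fun p : ℝ × ℝ => smoothPos p.1 p.2 := by
  unfold smoothPos
  fun_prop

lemma smoothPos_zero (t : ℝ) : smoothPos 0 t = max t 0 := by
  rcases le_total 0 t with h | h
  · simp [smoothPos, Real.sqrt_sq_eq_abs, abs_of_nonneg h, max_eq_left h]
  · simp [smoothPos, Real.sqrt_sq_eq_abs, abs_of_nonpos h, max_eq_right h]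

lemma smoothStep_mem {δ : ℝ} (hδ : 0 < δ) (t : ℝ) : smoothStep δ t ∈ Set.Icc (0 : ℝ) 1 := by
  have hr := Real.sqrt_pos.2 (sq_add_sq_pos hδ t)
  have h1 : |t| ≤ √(t ^ 2 + δ ^ 2) := Real.abs_le_sqrt (by nlinarith)
  have h2 := abs_le.1 h1
  have h3 : t / √(t ^ 2 + δ ^ 2) ≤ 1 := (div_le_one hr).2 h2.2
  have h4 : -1 ≤ t / √(t ^ 2 + δ ^ 2) := (le_div_iff₀ hr).2 (by linarith)
  constructor <;> unfold smoothStep <;> linarith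

lemma abs_smoothPos_le {δ t : ℝ} (hδ : 0 ≤ δ) : |smoothPos δ t| ≤ |t| + δ := by
  have h1 : √(t ^ 2 + δ ^ 2) ≤ |t| + δ := by
    rw [Real.sqrt_le_left (by positivity), add_sq, sq_abs]
    have : 0 ≤ |t| * δ := by positivity
    linarith
  have h2 := Real.sqrt_nonneg (t ^ 2 + δ ^ 2)
  have h3 := abs_le.1 (le_refl |t|)
  unfold smoothPos
  rw [abs_le]
  constructor <;> linarith [abs_nonneg t]

lemma hasDerivAt_smoothPos {δ : ℝ} (hδ : 0 < δ) (t : ℝ) :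
    HasDerivAt (smoothPos δ) (smoothStep δ t) t := by
  have h := ((((hasDerivAt_id t).pow 2).add_const (δ ^ 2)).sqrt (sq_add_sq_pos hδ t).ne')
  have h2 := ((hasDerivAt_id t).add h).div_const 2
  have e : (1 + ((2 : ℕ) : ℝ) * id t ^ (2 - 1) * 1 / (2 * √((id ^ 2) t + δ ^ 2))) / 2
      = smoothStep δ t := by
    have := (Real.sqrt_pos.2 (sq_add_sq_pos hδ t)).ne'
    simp only [smoothStep, Pi.pow_apply, id]
    field_simp
    simp [mul_add]
  exact e ▸ h2

end SmoothMax

/-! ### Submodularity of the variation for smooth functions -/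

section Approximation

variable {n : ℕ} {φ ψ η : EuclideanSpace ℝ (Fin n) → EuclideanSpace ℝ (Fin n)}

/-- By the chain rule, `smoothPos δ (w) • η` and `w • (smoothStep δ (w) • η)` have the same
first-order term, so the two integrands differ by a divergence of compactly supported fields, which
integrates to zero. -/
lemma integral_smoothPos_mul_divergence {w : EuclideanSpace ℝ (Fin n) → ℝ} {δ : ℝ} (hδ : 0 < δ)
    (hw : ContDiff ℝ 1 w) (hη : ContDiff ℝ 1 η) (hc : HasCompactSupport η) :
    ∫ x, smoothPos δ (w x) * divergence η x =
      ∫ x, w x * divergence (fun y => smoothStep δ (w y) • η y) x := by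
  have hp : ContDiff ℝ 1 fun x => smoothPos δ (w x) := (contDiff_smoothPos hδ).comp hw
  have hs : ContDiff ℝ 1 fun x => smoothStep δ (w x) := (contDiff_smoothStep hδ).comp hw
  have hsη : ContDiff ℝ 1 fun x => smoothStep δ (w x) • η x := hs.smul hη
  have hsc : HasCompactSupport fun x => smoothStep δ (w x) • η x := hc.smul_field _
  have hI1 : Integrable fun x => divergence (fun y => smoothPos δ (w y) • η y) x :=
    integrable_divergence (hp.smul hη) (hc.smul_field _)
  have hI2 : Integrable fun x => divergence (fun y => w y • (smoothStep δ (w y) • η y)) x :=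
    integrable_divergence (hw.smul hsη) (hsc.smul_field _)
  have hI3 : Integrable fun x => smoothPos δ (w x) * divergence η x :=
    integrable_mul_divergence hp.continuous hη hc
  have hI4 : Integrable fun x => w x * divergence (fun y => smoothStep δ (w y) • η y) x :=
    integrable_mul_divergence hw.continuous hsη hsc
  have hpt (x : EuclideanSpace ℝ (Fin n)) :
      smoothPos δ (w x) * divergence η x - w x * divergence (fun y => smoothStep δ (w y) • η y) x
        = divergence (fun y => smoothPos δ (w y) • η y) x
          - divergence (fun y => w y • (smoothStep δ (w y) • η y)) x := by
    rw [divergence_smul hp hη, divergence_smul hw hsη]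
    have := (hasDerivAt_smoothPos hδ (w x)).comp_hasFDerivAt x
      ((hw.differentiable one_ne_zero) x).hasFDerivAt
    have h2 : fderiv ℝ (fun y => smoothPos δ (w y)) x = smoothStep δ (w x) • fderiv ℝ w x :=
      this.fderiv
    rw [h2]
    simp
  have h0 : ∫ x, divergence (fun y => smoothPos δ (w y) • η y) x = 0 :=
    integral_divergence_eq_zero (hp.smul hη) (hc.smul_field _)
  have h1 : ∫ x, divergence (fun y => w y • (smoothStep δ (w y) • η y)) x = 0 :=
    integral_divergence_eq_zero (hw.smul hsη) (hsc.smul_field _)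
  rw [← sub_eq_zero, ← integral_sub hI3 hI4, integral_congr_ae (ae_of_all _ hpt),
    integral_sub hI1 hI2, h0, h1, sub_zero]

/-- The bound survives because the unit ball is convex. -/
lemma IsTestField.blend {χ : EuclideanSpace ℝ (Fin n) → ℝ} (hφ : IsTestField φ)
    (hψ : IsTestField ψ) (hχ : ContDiff ℝ 1 χ) (h01 : ∀ x, χ x ∈ Set.Icc (0 : ℝ) 1) :
    IsTestField fun x => ψ x + χ x • (φ x - ψ x) := by
  refine ⟨hψ.1.add (hχ.smul (hφ.1.sub hψ.1)), hψ.2.1.add ((hφ.2.1.sub_field hψ.2.1).smul_field χ), ?_⟩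
  intro x
  have h := h01 x
  have e : ψ x + χ x • (φ x - ψ x) = (1 - χ x) • ψ x + χ x • φ x := by module
  change ‖ψ x + χ x • (φ x - ψ x)‖ ≤ 1
  rw [e]
  calc _ ≤ ‖(1 - χ x) • ψ x‖ + ‖χ x • φ x‖ := norm_add_le _ _
    _ = (1 - χ x) * ‖ψ x‖ + χ x * ‖φ x‖ := by
      rw [norm_smul, norm_smul, Real.norm_of_nonneg h.1, Real.norm_of_nonneg (sub_nonneg.2 h.2)]
    _ ≤ (1 - χ x) * 1 + χ x * 1 :=
      add_le_add (mul_le_mul_of_nonneg_left (hψ.2.2 x) (sub_nonneg.2 h.2))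
        (mul_le_mul_of_nonneg_left (hφ.2.2 x) h.1)
    _ = 1 := by ring

/-- Submodularity of the variation for smooth functions, with `max f g` and `min f g` replaced by
smooth approximations. -/
lemma integral_smoothMax_add_smoothMin_le {f g : EuclideanSpace ℝ (Fin n) → ℝ} {a b δ : ℝ}
    (hδ : 0 < δ) (hf : ContDiff ℝ 1 f) (hg : ContDiff ℝ 1 g)
    (ha : ∀ φ, IsTestField φ → ∫ x, f x * divergence φ x ≤ a)
    (hb : ∀ φ, IsTestField φ → ∫ x, g x * divergence φ x ≤ b)
    (hφ : IsTestField φ) (hψ : IsTestField ψ) :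
    (∫ x, (g x + smoothPos δ (f x - g x)) * divergence φ x)
      + ∫ x, (f x - smoothPos δ (f x - g x)) * divergence ψ x ≤ a + b := by
  have hw : ContDiff ℝ 1 fun x => f x - g x := hf.sub hg
  have hp : ContDiff ℝ 1 fun x => smoothPos δ (f x - g x) := (contDiff_smoothPos hδ).comp hw
  have hs : ContDiff ℝ 1 fun x => smoothStep δ (f x - g x) := (contDiff_smoothStep hδ).comp hw
  have hη : ContDiff ℝ 1 fun x => φ x - ψ x := hφ.1.sub hψ.1
  have hηc : HasCompactSupport fun x => φ x - ψ x := hφ.2.1.sub_field hψ.2.1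
  have hζ : ContDiff ℝ 1 fun x => smoothStep δ (f x - g x) • (φ x - ψ x) := hs.smul hη
  have hζc : HasCompactSupport fun x => smoothStep δ (f x - g x) • (φ x - ψ x) := hηc.smul_field _
  have h01 := fun x => smoothStep_mem hδ (f x - g x)
  -- The two complementary blends of `φ` and `ψ`; their sum is `φ + ψ`.
  have hΦ := hφ.blend hψ hs h01
  have hΨ : IsTestField fun x => φ x - smoothStep δ (f x - g x) • (φ x - ψ x) := by
    convert hψ.blend hφ hs h01 using 2
    module
  have hint {k : EuclideanSpace ℝ (Fin n) → ℝ}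
      {ξ : EuclideanSpace ℝ (Fin n) → EuclideanSpace ℝ (Fin n)} (hk : ContDiff ℝ 1 k)
      (hξ : ContDiff ℝ 1 ξ) (hξc : HasCompactSupport ξ) :
      Integrable fun x => k x * divergence ξ x :=
    integrable_mul_divergence hk.continuous hξ hξc
  have hbase : Integrable fun x => g x * divergence φ x + f x * divergence ψ x :=
    (hint hg hφ.1 hφ.2.1).add (hint hf hψ.1 hψ.2.1)
  have key := integral_smoothPos_mul_divergence hδ hw hη hηc
  have h1 := ha _ hΦ
  have h2 := hb _ hΨ
  have e1 : (∫ x, (g x + smoothPos δ (f x - g x)) * divergence φ x)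
      + ∫ x, (f x - smoothPos δ (f x - g x)) * divergence ψ x
      = ((∫ x, g x * divergence φ x) + ∫ x, f x * divergence ψ x)
        + ∫ x, smoothPos δ (f x - g x) * divergence (fun x => φ x - ψ x) x := by
    rw [← integral_add (hint (hg.add hp) hφ.1 hφ.2.1) (hint (hf.sub hp) hψ.1 hψ.2.1),
      ← integral_add (hint hg hφ.1 hφ.2.1) (hint hf hψ.1 hψ.2.1),
      ← integral_add hbase (hint hp hη hηc)]
    refine integral_congr_ae (ae_of_all _ fun x => ?_)
    simp only [divergence_sub hφ.1 hψ.1]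
    ring
  have e2 : (∫ x, f x * divergence (fun x => ψ x + smoothStep δ (f x - g x) • (φ x - ψ x)) x)
      + ∫ x, g x * divergence (fun x => φ x - smoothStep δ (f x - g x) • (φ x - ψ x)) x
      = ((∫ x, g x * divergence φ x) + ∫ x, f x * divergence ψ x)
        + ∫ x, (f x - g x) * divergence (fun y => smoothStep δ (f y - g y) • (φ y - ψ y)) x := by
    rw [← integral_add (hint hf hΦ.1 hΦ.2.1) (hint hg hΨ.1 hΨ.2.1),
      ← integral_add (hint hg hφ.1 hφ.2.1) (hint hf hψ.1 hψ.2.1),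
      ← integral_add hbase (hint hw hζ hζc)]
    refine integral_congr_ae (ae_of_all _ fun x => ?_)
    simp only [divergence_sub hφ.1 hζ, divergence_add hψ.1 hζ]
    ring
  linarith

end Approximation

/-! ### Passage to bounded measurable functions -/

section Mollification

open scoped Convolution
open ContinuousLinearMap (lsmul)

variable {n : ℕ} {φ ψ : EuclideanSpace ℝ (Fin n) → EuclideanSpace ℝ (Fin n)}
  {u v : EuclideanSpace ℝ (Fin n) → ℝ}

lemma IsTestField.comp_add_right (hφ : IsTestField φ) (t : EuclideanSpace ℝ (Fin n)) :
    IsTestField fun x => φ (x + t) :=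
  ⟨hφ.1.comp (contDiff_id.add contDiff_const), hφ.2.1.comp_homeomorph (Homeomorph.addRight t),
    fun x => hφ.2.2 (x + t)⟩

lemma locallyIntegrable_of_abs_le_one (hu : Measurable u) (h1 : ∀ x, |u x| ≤ 1) :
    LocallyIntegrable u :=
  (locallyIntegrable_const (1 : ℝ)).mono hu.aestronglyMeasurable
    (ae_of_all _ fun x => by simpa using h1 x)

lemma contDiff_mollify (hu : Measurable u) (h1 : ∀ x, |u x| ≤ 1)
    (ρ : ContDiffBump (0 : EuclideanSpace ℝ (Fin n))) :
    ContDiff ℝ 1 (ρ.normed volume ⋆[lsmul ℝ ℝ, volume] u) :=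
  ρ.hasCompactSupport_normed.contDiff_convolution_left (n := 1) _ ρ.contDiff_normed
    (locallyIntegrable_of_abs_le_one hu h1)

lemma abs_mollify_le_one (h1 : ∀ x, |u x| ≤ 1)
    (ρ : ContDiffBump (0 : EuclideanSpace ℝ (Fin n))) (x : EuclideanSpace ℝ (Fin n)) :
    |(ρ.normed volume ⋆[lsmul ℝ ℝ, volume] u) x| ≤ 1 := by
  rw [← Real.norm_eq_abs, ← ρ.integral_normed (μ := volume)]
  refine norm_integral_le_of_norm_le ρ.integrable_normed (ae_of_all _ fun t => ?_)
  have h0 := ρ.nonneg_normed (μ := volume) t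
  simp only [ContinuousLinearMap.lsmul_apply, smul_eq_mul, norm_mul, Real.norm_eq_abs, abs_of_nonneg h0]
  exact mul_le_of_le_one_right h0 (h1 _)

/-- Mollification does not increase the variation. -/
lemma integral_mollify_mul_divergence_le {a : ℝ} (hu : Measurable u) (h1 : ∀ x, |u x| ≤ 1)
    (ha : ∀ φ, IsTestField φ → ∫ x, u x * divergence φ x ≤ a)
    (ρ : ContDiffBump (0 : EuclideanSpace ℝ (Fin n))) (hφ : IsTestField φ) :
    ∫ x, (ρ.normed volume ⋆[lsmul ℝ ℝ, volume] u) x * divergence φ x ≤ a := by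
  have hdi := integrable_divergence hφ.1 hφ.2.1
  have hint : Integrable (fun p : EuclideanSpace ℝ (Fin n) × EuclideanSpace ℝ (Fin n) =>
      ρ.normed volume p.2 * u (p.1 - p.2) * divergence φ p.1) (volume.prod volume) := by
    have hb := (hdi.mul_prod (ρ.integrable_normed (μ := volume))).bdd_mul (c := 1)
      (f := fun p : EuclideanSpace ℝ (Fin n) × EuclideanSpace ℝ (Fin n) => u (p.1 - p.2))
      (hu.comp (measurable_fst.sub measurable_snd)).aestronglyMeasurable
      (ae_of_all _ fun p => h1 _)
    refine hb.congr (ae_of_all _ fun p => ?_)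
    simp only
    ring
  have e1 : ∫ x, (ρ.normed volume ⋆[lsmul ℝ ℝ, volume] u) x * divergence φ x
      = ∫ x, ∫ t, ρ.normed volume t * u (x - t) * divergence φ x := by
    refine integral_congr_ae (ae_of_all _ fun x => ?_)
    simp only [convolution, integral_mul_const]
    rfl
  -- By Fubini and a translation of `x`, the mollified integral is an average over `t` of integrals
  -- of `u` against translated test fields, each at most `a`.
  have e2 (t : EuclideanSpace ℝ (Fin n)) : ∫ x, ρ.normed volume t * u (x - t) * divergence φ x
      = ρ.normed volume t * ∫ x, u x * divergence (fun y => φ (y + t)) x := by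
    rw [← integral_const_mul, ← integral_add_right_eq_self _ t]
    refine integral_congr_ae (ae_of_all _ fun x => ?_)
    simp only [add_sub_cancel_right, divergence_comp_add_right]
    ring
  rw [e1, integral_integral_swap hint]
  calc ∫ t, ∫ x, ρ.normed volume t * u (x - t) * divergence φ x
      ≤ ∫ t, ρ.normed volume t * a := by
        refine integral_mono hint.integral_prod_right (ρ.integrable_normed.mul_const a) fun t => ?_
        simp only [e2]
        exact mul_le_mul_of_nonneg_left (ha _ (hφ.comp_add_right t)) (ρ.nonneg_normed t)
    _ = a := by rw [integral_mul_const, ρ.integral_normed, one_mul]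

/-- Submodularity of the variation of bounded functions. -/
lemma integral_max_add_integral_min_le {a b : ℝ} (hu : Measurable u) (hv : Measurable v)
    (hu1 : ∀ x, |u x| ≤ 1) (hv1 : ∀ x, |v x| ≤ 1)
    (ha : ∀ φ, IsTestField φ → ∫ x, u x * divergence φ x ≤ a)
    (hb : ∀ φ, IsTestField φ → ∫ x, v x * divergence φ x ≤ b)
    (hφ : IsTestField φ) (hψ : IsTestField ψ) :
    (∫ x, max (u x) (v x) * divergence φ x) + ∫ x, min (u x) (v x) * divergence ψ x ≤ a + b := by
  -- One parameter drives both the mollification radius and the smoothing of the positive part.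
  set δ : ℕ → ℝ := fun k => 1 / ((k : ℝ) + 1) with hδ
  have hδ0 : ∀ k, 0 < δ k := fun k => Nat.one_div_pos_of_nat
  have hδ1 : ∀ k, δ k ≤ 1 := fun k => by
    rw [hδ]
    exact (div_le_one (by positivity)).2 (by linarith [(Nat.cast_nonneg k : (0 : ℝ) ≤ k)])
  have hδlim : Tendsto δ atTop (𝓝 0) := tendsto_one_div_add_atTop_nhds_zero_nat
  let ρ : ℕ → ContDiffBump (0 : EuclideanSpace ℝ (Fin n)) := fun k =>
    ⟨δ k, 2 * δ k, hδ0 k, by linarith [hδ0 k]⟩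
  have hρ : Tendsto (fun k => (ρ k).rOut) atTop (𝓝 0) := by
    simpa using hδlim.const_mul 2
  -- Comparable inner and outer radii are what the a.e. convergence of mollifications requires.
  have hK : ∀ᶠ k in atTop, (ρ k).rOut ≤ 2 * (ρ k).rIn := Eventually.of_forall fun k => le_rfl
  set f : ℕ → EuclideanSpace ℝ (Fin n) → ℝ :=
    fun k => (ρ k).normed volume ⋆[lsmul ℝ ℝ, volume] u with hf
  set g : ℕ → EuclideanSpace ℝ (Fin n) → ℝ :=
    fun k => (ρ k).normed volume ⋆[lsmul ℝ ℝ, volume] v with hg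
  have hfc : ∀ k, ContDiff ℝ 1 (f k) := fun k => contDiff_mollify hu hu1 (ρ k)
  have hgc : ∀ k, ContDiff ℝ 1 (g k) := fun k => contDiff_mollify hv hv1 (ρ k)
  have hf1 : ∀ k x, |f k x| ≤ 1 := fun k => abs_mollify_le_one hu1 (ρ k)
  have hg1 : ∀ k x, |g k x| ≤ 1 := fun k => abs_mollify_le_one hv1 (ρ k)
  have hft := ContDiffBump.ae_convolution_tendsto_right_of_locallyIntegrable (μ := volume) hρ hK
    (locallyIntegrable_of_abs_le_one hu hu1)
  have hgt := ContDiffBump.ae_convolution_tendsto_right_of_locallyIntegrable (μ := volume) hρ hK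
    (locallyIntegrable_of_abs_le_one hv hv1)
  have hpc : ∀ k, Continuous fun x => smoothPos (δ k) (f k x - g k x) := fun k =>
    (contDiff_smoothPos (hδ0 k)).continuous.comp ((hfc k).continuous.sub (hgc k).continuous)
  -- The bound is `|f| + |g| + δ ≤ 3`; one more summand of size at most 1 gives the dominating
  -- factor 4 below.
  have hp3 : ∀ k x, |smoothPos (δ k) (f k x - g k x)| ≤ 3 := fun k x => by
    have h1 := abs_smoothPos_le (t := f k x - g k x) (hδ0 k).le
    have h2 := abs_sub (f k x) (g k x)
    linarith [hf1 k x, hg1 k x, hδ1 k]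
  have hpt : ∀ᵐ x : EuclideanSpace ℝ (Fin n),
      Tendsto (fun k => smoothPos (δ k) (f k x - g k x)) atTop (𝓝 (max (u x - v x) 0)) := by
    filter_upwards [hft, hgt] with x hx hy
    rw [← smoothPos_zero]
    exact (continuous_smoothPos_uncurry.tendsto (0, u x - v x)).comp
      (hδlim.prodMk_nhds (hx.sub hy))
  have hL1 : Tendsto (fun k => ∫ x, (g k x + smoothPos (δ k) (f k x - g k x)) * divergence φ x)
      atTop (𝓝 (∫ x, max (u x) (v x) * divergence φ x)) := by
    refine tendsto_integral_of_dominated_convergence (fun x => 4 * |divergence φ x|)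
      (fun k => (((hgc k).continuous.add (hpc k)).mul
        (continuous_divergence hφ.1)).aestronglyMeasurable)
      ((integrable_divergence hφ.1 hφ.2.1).abs.const_mul 4) (fun k => ae_of_all _ fun x => ?_) ?_
    · rw [Real.norm_eq_abs, abs_mul]
      have := abs_add_le (g k x) (smoothPos (δ k) (f k x - g k x))
      exact mul_le_mul_of_nonneg_right (by linarith [hg1 k x, hp3 k x]) (abs_nonneg _)
    · filter_upwards [hgt, hpt] with x hx hy
      have e : max (u x) (v x) = v x + max (u x - v x) 0 := by
        rw [← max_add_add_left]; simp
      rw [e]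
      exact (hx.add hy).mul_const _
  have hL2 : Tendsto (fun k => ∫ x, (f k x - smoothPos (δ k) (f k x - g k x)) * divergence ψ x)
      atTop (𝓝 (∫ x, min (u x) (v x) * divergence ψ x)) := by
    refine tendsto_integral_of_dominated_convergence (fun x => 4 * |divergence ψ x|)
      (fun k => (((hfc k).continuous.sub (hpc k)).mul
        (continuous_divergence hψ.1)).aestronglyMeasurable)
      ((integrable_divergence hψ.1 hψ.2.1).abs.const_mul 4) (fun k => ae_of_all _ fun x => ?_) ?_
    · rw [Real.norm_eq_abs, abs_mul]
      have := abs_sub (f k x) (smoothPos (δ k) (f k x - g k x))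
      exact mul_le_mul_of_nonneg_right (by linarith [hf1 k x, hp3 k x]) (abs_nonneg _)
    · filter_upwards [hft, hpt] with x hx hy
      have e : min (u x) (v x) = u x - max (u x - v x) 0 := by
        rcases le_total (u x) (v x) with h | h
        · rw [min_eq_left h, max_eq_right (by linarith)]; ring
        · rw [min_eq_right h, max_eq_left (by linarith)]; ring
      rw [e]
      exact (hx.sub hy).mul_const _
  refine le_of_tendsto (hL1.add hL2) (Eventually.of_forall fun k => ?_)
  exact integral_smoothMax_add_smoothMin_le (hδ0 k) (hfc k) (hgc k)
    (fun _ h => integral_mollify_mul_divergence_le hu hu1 ha (ρ k) h)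
    (fun _ h => integral_mollify_mul_divergence_le hv hv1 hb (ρ k) h) hφ hψ

end Mollification

/-! ### Submodularity of the perimeter -/

section Perimeter

variable {n : ℕ} {A B : Set (EuclideanSpace ℝ (Fin n))}

lemma perimeter_congr (h : A =ᵐ[volume] B) : perimeter A = perimeter B := by
  simp only [perimeter, setIntegral_congr_set h]

lemma setIntegral_divergence_le_perimeter (hA : perimeter A ≠ ∞)
    {φ : EuclideanSpace ℝ (Fin n) → EuclideanSpace ℝ (Fin n)} (hφ : IsTestField φ) :
    ∫ x in A, divergence φ x ≤ (perimeter A).toReal := by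
  rw [← ENNReal.ofReal_le_iff_le_toReal hA]
  exact le_iSup₂_of_le φ hφ le_rfl

lemma isTestField_zero : IsTestField (0 : EuclideanSpace ℝ (Fin n) → EuclideanSpace ℝ (Fin n)) :=
  ⟨contDiff_const, HasCompactSupport.zero, fun x => by simp⟩

/-- `ENNReal.ofReal` truncates negative integrals and is additive only on nonnegative reals; passing
to the zero field realizes the truncation by an actual test field. -/
lemma exists_isTestField_integral_eq_max
    {φ : EuclideanSpace ℝ (Fin n) → EuclideanSpace ℝ (Fin n)} (hφ : IsTestField φ) :
    ∃ ψ, IsTestField ψ ∧ ∫ x in A, divergence ψ x = max (∫ x in A, divergence φ x) 0 := by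
  rcases le_total 0 (∫ x in A, divergence φ x) with h | h
  · exact ⟨φ, hφ, (max_eq_left h).symm⟩
  · exact ⟨0, isTestField_zero, by rw [max_eq_right h]; simp [divergence]⟩

/-- The max and min of two indicators are the indicators of union and intersection. The test fields
`φ` and `ψ` are independent, so both suprema can be taken separately. -/
lemma perimeter_union_add_inter_le_of_measurableSet (hA : MeasurableSet A)
    (hB : MeasurableSet B) :
    perimeter (A ∪ B) + perimeter (A ∩ B) ≤ perimeter A + perimeter B := by
  by_cases hAt : perimeter A = ∞
  · simp [hAt]
  by_cases hBt : perimeter B = ∞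
  · simp [hBt]
  have hind {C : Set (EuclideanSpace ℝ (Fin n))} (hC : MeasurableSet C)
      (φ : EuclideanSpace ℝ (Fin n) → EuclideanSpace ℝ (Fin n)) :
      ∫ x in C, divergence φ x = ∫ x, C.indicator (fun _ => (1 : ℝ)) x * divergence φ x := by
    rw [← integral_indicator hC]
    congr 1 with x
    by_cases hx : x ∈ C <;> simp [hx]
  have h1 (C : Set (EuclideanSpace ℝ (Fin n))) (x : EuclideanSpace ℝ (Fin n)) :
      |C.indicator (fun _ => (1 : ℝ)) x| ≤ 1 := by
    by_cases hx : x ∈ C <;> simp [hx]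
  have key {φ ψ} (hφ : IsTestField φ) (hψ : IsTestField ψ) :
      (∫ x in A ∪ B, divergence φ x) + ∫ x in A ∩ B, divergence ψ x
        ≤ (perimeter A).toReal + (perimeter B).toReal := by
    have := integral_max_add_integral_min_le (measurable_const.indicator hA)
      (measurable_const.indicator hB) (h1 A) (h1 B)
      (fun φ h => (hind hA φ).symm.trans_le (setIntegral_divergence_le_perimeter hAt h))
      (fun φ h => (hind hB φ).symm.trans_le (setIntegral_divergence_le_perimeter hBt h)) hφ hψ
    rw [hind (hA.union hB), hind (hA.inter hB)]
    convert this using 6 with x x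
    · by_cases hx : x ∈ A <;> by_cases hy : x ∈ B <;> simp [hx, hy]
    · by_cases hx : x ∈ A <;> by_cases hy : x ∈ B <;> simp [hx, hy]
  have hsum : perimeter A + perimeter B
      = ENNReal.ofReal ((perimeter A).toReal + (perimeter B).toReal) := by
    rw [ENNReal.ofReal_add ENNReal.toReal_nonneg ENNReal.toReal_nonneg, ENNReal.ofReal_toReal hAt,
      ENNReal.ofReal_toReal hBt]
  have hne : Nonempty
      {φ : EuclideanSpace ℝ (Fin n) → EuclideanSpace ℝ (Fin n) // IsTestField φ} :=
    ⟨⟨0, isTestField_zero⟩⟩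
  have hper (C : Set (EuclideanSpace ℝ (Fin n))) : perimeter C
      = ⨆ φ : {φ : EuclideanSpace ℝ (Fin n) → EuclideanSpace ℝ (Fin n) // IsTestField φ},
        ENNReal.ofReal (∫ x in C, divergence φ.1 x) := by
    rw [iSup_subtype]
    rfl
  rw [hsum, hper (A ∪ B), hper (A ∩ B)]
  refine ENNReal.iSup_add_iSup_le fun φ ψ => ?_
  obtain ⟨φ', hφ', e1⟩ := exists_isTestField_integral_eq_max (A := A ∪ B) φ.2
  obtain ⟨ψ', hψ', e2⟩ := exists_isTestField_integral_eq_max (A := A ∩ B) ψ.2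
  have h := key hφ' hψ'
  rw [e1, e2] at h
  calc _ ≤ ENNReal.ofReal (max (∫ x in A ∪ B, divergence φ.1 x) 0)
        + ENNReal.ofReal (max (∫ x in A ∩ B, divergence ψ.1 x) 0) := by
        gcongr <;> exact le_max_left _ _
    _ ≤ _ := by
        rw [← ENNReal.ofReal_add (le_max_right _ _) (le_max_right _ _)]
        exact ENNReal.ofReal_le_ofReal h

/-- Submodularity of the perimeter. -/
theorem perimeter_union_add_perimeter_inter_le (hA : NullMeasurableSet A)
    (hB : NullMeasurableSet B) :
    perimeter (A ∪ B) + perimeter (A ∩ B) ≤ perimeter A + perimeter B := by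
  obtain ⟨A', -, hA', eA⟩ := hA.exists_measurable_superset_ae_eq
  obtain ⟨B', -, hB', eB⟩ := hB.exists_measurable_superset_ae_eq
  rw [← perimeter_congr eA, ← perimeter_congr eB, ← perimeter_congr (eA.union eB),
    ← perimeter_congr (eA.inter eB)]
  exact perimeter_union_add_inter_le_of_measurableSet hA' hB'

end Perimeter

/-! ### Submodularity of the scheme energy -/

section Scheme

variable {n : ℕ} {E E₁ E₂ F₁ F₂ : Set (EuclideanSpace ℝ (Fin n))}

lemma EReal.abs_coe_ennreal (a : ℝ≥0∞) : (a : EReal).abs = a := by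
  induction a with
  | top => rfl
  | coe a =>
    change ((a : ℝ) : EReal).abs = a
    simp [EReal.abs_def]

lemma abs_setSignedDist (E : Set (EuclideanSpace ℝ (Fin n))) (x : EuclideanSpace ℝ (Fin n)) :
    (setSignedDist E x).abs = Metric.infEDist x E + Metric.infEDist x Eᶜ := by
  by_cases hx : x ∈ E
  · simp [setSignedDist, Metric.infEDist_zero_of_mem hx, EReal.abs_coe_ennreal]
  · have : x ∈ Eᶜ := hx
    simp [setSignedDist, Metric.infEDist_zero_of_mem this, EReal.abs_coe_ennreal]

lemma measurable_abs_setSignedDist (E : Set (EuclideanSpace ℝ (Fin n))) :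
    Measurable fun x => (setSignedDist E x).abs := by
  simp only [abs_setSignedDist]
  exact (Metric.continuous_infEDist.add Metric.continuous_infEDist).measurable

/-- Only `x ∈ F₁ \ F₂` matters; otherwise both sides agree. There, if `x ∈ E₁`, distances to the
complements are compared; if `x ∉ E₂`, distances to the sets; if `x ∈ E₂ \ E₁`, the left side
vanishes. -/
lemma indicator_symmDiff_setSignedDist_le (hE : E₁ ⊆ E₂) (x : EuclideanSpace ℝ (Fin n)) :
    ((F₁ ∩ F₂) ∆ E₁).indicator (fun x => (setSignedDist E₁ x).abs) x
        + ((F₁ ∪ F₂) ∆ E₂).indicator (fun x => (setSignedDist E₂ x).abs) x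
      ≤ (F₁ ∆ E₁).indicator (fun x => (setSignedDist E₁ x).abs) x
        + (F₂ ∆ E₂).indicator (fun x => (setSignedDist E₂ x).abs) x := by
  have hd : Metric.infEDist x E₂ ≤ Metric.infEDist x E₁ := Metric.infEDist_anti hE
  have hd' : Metric.infEDist x E₁ᶜ ≤ Metric.infEDist x E₂ᶜ :=
    Metric.infEDist_anti (Set.compl_subset_compl.2 hE)
  have hin {E : Set (EuclideanSpace ℝ (Fin n))} (hx : x ∈ E) : Metric.infEDist x E = 0 :=
    Metric.infEDist_zero_of_mem hx
  have hout {E : Set (EuclideanSpace ℝ (Fin n))} (hx : x ∉ E) : Metric.infEDist x Eᶜ = 0 :=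
    Metric.infEDist_zero_of_mem hx
  classical
  simp only [abs_setSignedDist, Set.indicator_apply, Set.mem_symmDiff, Set.mem_inter_iff,
    Set.mem_union]
  by_cases hF₁ : x ∈ F₁ <;> by_cases hF₂ : x ∈ F₂ <;> by_cases h₁ : x ∈ E₁ <;>
    by_cases h₂ : x ∈ E₂ <;> simp [hF₁, hF₂, h₁, h₂]
  all_goals first
    | exact absurd (hE h₁) h₂
    | simpa [hin h₁, hin h₂] using hd'
    | simpa [hout h₁, hout h₂] using hd

lemma lintegral_symmDiff_setSignedDist_le (hE : E₁ ⊆ E₂) (hE₁ : NullMeasurableSet E₁)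
    (hE₂ : NullMeasurableSet E₂) (hF₁ : NullMeasurableSet F₁) (hF₂ : NullMeasurableSet F₂) :
    (∫⁻ x in (F₁ ∩ F₂) ∆ E₁, (setSignedDist E₁ x).abs)
        + ∫⁻ x in (F₁ ∪ F₂) ∆ E₂, (setSignedDist E₂ x).abs
      ≤ (∫⁻ x in F₁ ∆ E₁, (setSignedDist E₁ x).abs)
        + ∫⁻ x in F₂ ∆ E₂, (setSignedDist E₂ x).abs := by
  have hm {A B : Set (EuclideanSpace ℝ (Fin n))} (hA : NullMeasurableSet A)
      (hB : NullMeasurableSet B) : NullMeasurableSet (A ∆ B) := (hA.diff hB).union (hB.diff hA)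
  have m₁ := hm (hF₁.inter hF₂) hE₁
  have m₂ := hm (hF₁.union hF₂) hE₂
  have m₃ := hm hF₁ hE₁
  have m₄ := hm hF₂ hE₂
  rw [← lintegral_indicator₀ m₁, ← lintegral_indicator₀ m₂, ← lintegral_indicator₀ m₃,
    ← lintegral_indicator₀ m₄,
    ← lintegral_add_left' ((measurable_abs_setSignedDist E₁).aemeasurable.indicator₀ m₁),
    ← lintegral_add_left' ((measurable_abs_setSignedDist E₁).aemeasurable.indicator₀ m₃)]
  exact lintegral_mono fun x => indicator_symmDiff_setSignedDist_le hE x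

theorem schemeEnergy_inter_add_schemeEnergy_union_le (h : ℝ) (hE : E₁ ⊆ E₂)
    (hE₁ : NullMeasurableSet E₁) (hE₂ : NullMeasurableSet E₂) (hF₁ : NullMeasurableSet F₁)
    (hF₂ : NullMeasurableSet F₂) :
    schemeEnergy h E₁ (F₁ ∩ F₂) + schemeEnergy h E₂ (F₁ ∪ F₂)
      ≤ schemeEnergy h E₁ F₁ + schemeEnergy h E₂ F₂ := by
  have hp := perimeter_union_add_perimeter_inter_le hF₁ hF₂
  have hd := lintegral_symmDiff_setSignedDist_le hE hE₁ hE₂ hF₁ hF₂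
  unfold schemeEnergy
  rw [add_add_add_comm, ← mul_add, add_add_add_comm (perimeter F₁), ← mul_add,
    add_comm (perimeter (F₁ ∩ F₂))]
  gcongr

end Scheme

/-! ### Comparison of maximal minimizers -/

theorem mainTheorem8 (n : ℕ) (h : ℝ) (hh : 0 < h)
    (Ω₁ Ω₂ E₁ E₂ F₁ F₂ : Set (EuclideanSpace ℝ (Fin n)))
    (hΩ : Ω₁ ⊆ Ω₂) (hE : E₁ ⊆ E₂) (hΩE₁ : Ω₁ ⊆ E₁) (hΩE₂ : Ω₂ ⊆ E₂)
    (hull₁ : IsMinimizingHull E₁) (hull₂ : IsMinimizingHull E₂)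
    (hF₁ : IsMaximalSchemeMinimizer h Ω₁ E₁ F₁) (hF₂ : IsMaximalSchemeMinimizer h Ω₂ E₂ F₂) :
    F₁ ≤ᵐ[volume] F₂ := by
  obtain ⟨⟨m₁, s₁, fin₁, min₁⟩, -⟩ := hF₁
  obtain ⟨⟨m₂, s₂, fin₂, min₂⟩, max₂⟩ := hF₂
  have hsub := schemeEnergy_inter_add_schemeEnergy_union_le h hE
    (nullMeasurableSet_of_null_frontier hull₁.1) (nullMeasurableSet_of_null_frontier hull₂.1) m₁ m₂
  have hinter := min₁ (F₁ ∩ F₂) (m₁.inter m₂) (Set.subset_inter s₁ (hΩ.trans s₂))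
  have hle : schemeEnergy h E₂ (F₁ ∪ F₂) ≤ schemeEnergy h E₂ F₂ :=
    -- Cancelling the energy of `F₁` in `ℝ≥0∞` needs its finiteness.
    (ENNReal.add_le_add_iff_left fin₁).1 ((add_le_add_left hinter _).trans hsub)
  have hunion : IsSchemeMinimizer h Ω₂ E₂ (F₁ ∪ F₂) :=
    ⟨m₁.union m₂, s₂.trans Set.subset_union_right, (hle.trans_lt fin₂.lt_top).ne,
      fun G hG hΩG => hle.trans (min₂ G hG hΩG)⟩
  exact (LE.le.eventuallyLE Set.subset_union_left).trans (max₂ _ hunion)
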